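/- Let $\Sigma$ be a finite, totally ordered alphabet, let $\prec$ be the co-lexicographic order on $\Sigma^*$ (words are compared lexicographically from right to left), and write $\preceq$ for its reflexive closure. All automata are finite, have exactly one initial state, and are trimmed (every state is reachable from the initial state and can reach a final state); a DFA is an automaton with transition function $\delta : Q \times \Sigma \to 2^Q$ satisfying $|\delta(q,a)| \le 1$ for all $q, a$. A Wheeler NFA is an automaton with a total order $<$ on its states such that the initial state is the minimum and has no incoming transitions and, whenever $v_1 \in \delta(u_1,a_1)$ and $v_2 \in \delta(u_2,a_2)$: (i) $a_1 \prec a_2$ implies $v_1 < v_2$; (ii) $a_1 = a_2$ and $u_1 < u_2$ imply $v_1 \le v_2$. A language is Wheeler if it is recognized by a Wheeler NFA. For $\mathcal L \subseteq \Sigma^*$ let $\mathrm{Pref}(\mathcal L)$ be the set of prefixes of words of $\mathcal L$. For $\alpha, \beta \in \mathrm{Pref}(\mathcal L)$ write $\alpha \equiv_{\mathcal L} \beta$ if $\{\gamma : \alpha\gamma \in \mathcal L\} = \{\gamma : \beta\gamma \in \mathcal L\}$, and write $\alpha \equiv^c_{\mathcal L} \beta$ if $\alpha \equiv_{\mathcal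 L} \beta$, the words $\alpha, \beta$ end with the same letter (or are both empty), and $\alpha \equiv_{\mathcal L} \gamma \equiv_{\mathcal L} \beta$ for every $\gamma \in \mathrm{Pref}(\mathcal L)$ with $\min(\alpha,\beta) \preceq \gamma \preceq \max(\alpha,\beta)$. Let $\mathcal L$ be a Wheeler language over $\Sigma$, let $\mathcal D_{\mathcal L}$ be the minimum DFA recognizing $\mathcal L$ (the one with the fewest states), and let $n$ be its number of states. Then every equivalence class $C$ of $\equiv^c_{\mathcal L}$ on $\mathrm{Pref}(\mathcal L)$ contains a word $\alpha$ with $|\alpha| < n + n^2$. -/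

import Mathlib

namespace WheelerLang

universe u v

section Automata

variable {α : Type u} {Q : Type v}

/-- An automaton has one initial state and is deterministic, with a partial transition function:
each state has at most one outgoing transition for each letter. -/
def IsDFA (A : NFA α Q) : Prop :=
  (∃ q₀ : Q, A.start = {q₀}) ∧ ∀ (q : Q) (a : α), (A.step q a).Subsingleton

/-- Every state is reachable from the initial state and can reach some final state. -/
def IsTrimmed (A : NFA α Q) : Prop :=
  ∀ q : Q, (∃ x : List α, q ∈ A.eval x) ∧ ∃ y : List α, ∃ f ∈ A.accept, f ∈ A.evalFrom {q} y

/-- `A` is a minimum DFA of `L`: a finite trimmed DFA recognizing `L` with the least possible number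
of states. (Any finite set of states can be found, up to renaming, in `Type`.) -/
structure IsMinimumDFA [Fintype Q] (A : NFA α Q) (L : Language α) : Prop where
  dfa : IsDFA A
  trimmed : IsTrimmed A
  accepts_eq : A.accepts = L
  card_le : ∀ (P : Type) [Fintype P] (B : NFA α P), IsDFA B → IsTrimmed B → B.accepts = L →
    Fintype.card Q ≤ Fintype.card P

/-- The Wheeler conditions on an automaton whose states carry a linear order. -/
structure IsWheelerNFA [LinearOrder α] [LinearOrder Q] (A : NFA α Q) : Prop where
  /-- There is one initial state; it is the least state and has no incoming transition. -/
  initial : ∃ q₀ : Q, A.start = {q₀} ∧ (∀ q, q₀ ≤ q) ∧ ∀ q a, q₀ ∉ A.step q a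
  lt_of_label_lt : ∀ {u₁ u₂ v₁ v₂ : Q} {a₁ a₂ : α}, v₁ ∈ A.step u₁ a₁ → v₂ ∈ A.step u₂ a₂ →
    a₁ < a₂ → v₁ < v₂
  le_of_source_lt : ∀ {u₁ u₂ v₁ v₂ : Q} {a : α}, v₁ ∈ A.step u₁ a → v₂ ∈ A.step u₂ a →
    u₁ < u₂ → v₁ ≤ v₂

end Automata

section Languages

variable {α : Type u}

/-- A language is Wheeler if it is recognized by some finite (trimmed) Wheeler NFA. -/
def IsWheelerLanguage [LinearOrder α] (L : Language α) : Prop :=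
  ∃ (Q : Type) (_ : Fintype Q) (_ : LinearOrder Q) (A : NFA α Q),
    IsTrimmed A ∧ IsWheelerNFA A ∧ A.accepts = L

/-- The set of prefixes of the words of `L`. -/
def pref (L : Language α) : Set (List α) := {x | ∃ y : List α, x ++ y ∈ L}

/-- Co-lexicographic order: compare the reversed words lexicographically
(`≤` and `<` on lists are lexicographic). -/
def ColexLE [LinearOrder α] (x y : List α) : Prop := x.reverse ≤ y.reverse

/-- The Myhill-Nerode equivalence: equality of right contexts `{z | x ++ z ∈ L}`. -/
def MyhillNerode (L : Language α) (x y : List α) : Prop := L.leftQuotient x = L.leftQuotient y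

/-- The input-consistent convex refinement of the Myhill-Nerode equivalence, for words in `pref L`.
The disjunction says that `z` lies between the co-lexicographic minimum and maximum
of `x` and `y`; `getLast?` is the last letter, if there is one. -/
structure ConvexEquiv [LinearOrder α] (L : Language α) (x y : List α) : Prop where
  myhillNerode : MyhillNerode L x y
  getLast_eq : x.getLast? = y.getLast?
  convex : ∀ z ∈ pref L, (ColexLE x z ∧ ColexLE z y) ∨ (ColexLE y z ∧ ColexLE z x) →
    MyhillNerode L x z ∧ MyhillNerode L z y

theorem ConvexEquiv.refl [LinearOrder α] (L : Language α) (x : List α) : ConvexEquiv L x x where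
  myhillNerode := rfl
  getLast_eq := rfl
  convex := by
    intro z _ h
    have e : x.reverse = z.reverse := by
      rcases h with h | h <;> exact le_antisymm h.1 h.2
    have e' : x = z := List.reverse_injective e
    subst e'
    exact ⟨rfl, rfl⟩

theorem ConvexEquiv.symm [LinearOrder α] {L : Language α} {x y : List α}
    (h : ConvexEquiv L x y) : ConvexEquiv L y x where
  myhillNerode := Eq.symm h.myhillNerode
  getLast_eq := h.getLast_eq.symm
  convex := fun z hz hb =>
    ⟨Eq.symm (h.convex z hz hb.symm).2, Eq.symm (h.convex z hz hb.symm).1⟩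

theorem ConvexEquiv.trans [LinearOrder α] {L : Language α} {x y w : List α}
    (h : ConvexEquiv L x y) (k : ConvexEquiv L y w) : ConvexEquiv L x w where
  myhillNerode := Eq.trans h.myhillNerode k.myhillNerode
  getLast_eq := h.getLast_eq.trans k.getLast_eq
  convex := by
    intro z hz hb
    have hxw : MyhillNerode L x w := Eq.trans h.myhillNerode k.myhillNerode
    have key : MyhillNerode L x z := by
      rcases le_total z.reverse y.reverse with c | c <;> rcases hb with hb | hb
      · exact (h.convex z hz (Or.inl ⟨hb.1, c⟩)).1
      · exact Eq.trans h.myhillNerode (k.convex z hz (Or.inr ⟨hb.1, c⟩)).1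
      · exact Eq.trans h.myhillNerode (k.convex z hz (Or.inl ⟨c, hb.2⟩)).1
      · exact (h.convex z hz (Or.inr ⟨c, hb.2⟩)).1
    exact ⟨key, Eq.trans (Eq.symm key) hxw⟩

/-- The equivalence relation `ConvexEquiv L` on the set `pref L`. -/
def convexSetoid [LinearOrder α] (L : Language α) : Setoid (pref L) where
  r x y := ConvexEquiv L x.1 y.1
  iseqv := ⟨fun x => ConvexEquiv.refl L x.1, ConvexEquiv.symm, ConvexEquiv.trans⟩

end Languages

end WheelerLang

/-! A prefix of length at least n + n² repeats a state of the DFA while reading its first n letters.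
Cutting out the loop keeps the Myhill-Nerode class and leaves a common suffix z with |z| ≥ n². Words
between the two versions also end in z, say y ++ z. Reading z in parallel from x and y visits more
than n² pairs of states, so some nonempty factor w of z loops on both sides
(`myhillNerode_of_between_append`). Pumping w then gives a monotone chain alternating between two
classes. In a Wheeler NFA the prefixes reaching a given state form a convex set, so the state sets
along the chain stabilize and the two classes coincide (`myhillNerode_of_pump`). The shortened word
is thus convexly equivalent to the original; iterate. -/

namespace WheelerLang

/-! ### Lexicographic order and common prefixes -/

section ListOrder

variable {α : Type*} [LinearOrder α]

theorem list_cons_le_cons_iff {a b : α} {l m : List α} :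
    a :: l ≤ b :: m ↔ a < b ∨ a = b ∧ l ≤ m := by
  rw [le_iff_lt_or_eq, List.cons_lt_cons_iff, List.cons.injEq, le_iff_lt_or_eq]
  tauto

theorem list_le_append (l t : List α) : l ≤ l ++ t := by
  induction l with
  | nil => exact not_lt.1 (List.not_lt_nil _)
  | cons a l ih =>
    rw [List.cons_append, list_cons_le_cons_iff]
    exact Or.inr ⟨rfl, ih⟩

theorem list_append_le_append_left_iff (z x y : List α) : z ++ x ≤ z ++ y ↔ x ≤ y := by
  induction z with
  | nil => rfl
  | cons a z ih => simp [list_cons_le_cons_iff, ih]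

/-- By length `l` is not a proper prefix of `m`, so the first difference lies inside `l` and `t` is
never consulted. -/
theorem list_append_lt_of_lt {l m : List α} (t : List α) (h : l < m)
    (hlen : m.length ≤ l.length) : l ++ t < m := by
  induction l generalizing m with
  | nil =>
    obtain rfl : m = [] := List.length_eq_zero_iff.1 (by simpa using hlen)
    exact absurd h (lt_irrefl _)
  | cons a l ih =>
    cases m with
    | nil => exact absurd h (List.not_lt_nil _)
    | cons b m =>
      rw [List.cons_append]
      rw [List.cons_lt_cons_iff] at h ⊢
      exact h.imp_right fun h => ⟨h.1, ih h.2 (by simpa using hlen)⟩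

/-- Words lying lexicographically between two words with a common prefix have that prefix. -/
theorem exists_eq_append_of_between {z x y w : List α} (h₁ : z ++ x ≤ w) (h₂ : w ≤ z ++ y) :
    ∃ v, w = z ++ v ∧ x ≤ v ∧ v ≤ y := by
  induction z generalizing w with
  | nil => exact ⟨w, rfl, h₁, h₂⟩
  | cons a z ih =>
    cases w with
    | nil => exact absurd h₁ (not_le.2 (List.nil_lt_cons _ _))
    | cons b w =>
      rw [List.cons_append, list_cons_le_cons_iff] at h₁ h₂
      rcases h₁ with h₁ | ⟨rfl, h₁⟩
      · rcases h₂ with h₂ | ⟨rfl, -⟩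
        · exact absurd h₁ h₂.asymm
        · exact absurd h₁ (lt_irrefl _)
      · rcases h₂ with h₂ | ⟨-, h₂⟩
        · exact absurd h₂ (lt_irrefl _)
        · obtain ⟨v, rfl, hv⟩ := ih h₁ h₂
          exact ⟨v, rfl, hv⟩

end ListOrder

section ColexLE

variable {α : Type*} [LinearOrder α] {x y z w : List α}

theorem colexLE_append_right_iff (z : List α) : ColexLE (x ++ z) (y ++ z) ↔ ColexLE x y := by
  simp [ColexLE, list_append_le_append_left_iff]

theorem ColexLE.exists_eq_append (h₁ : ColexLE (x ++ z) w) (h₂ : ColexLE w (y ++ z)) :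
    ∃ v, w = v ++ z ∧ ColexLE x v ∧ ColexLE v y := by
  unfold ColexLE at h₁ h₂
  rw [List.reverse_append] at h₁ h₂
  obtain ⟨v, hv, h₁, h₂⟩ := exists_eq_append_of_between h₁ h₂
  refine ⟨v.reverse, ?_, ?_, ?_⟩
  · simpa using congrArg List.reverse hv
  · simpa [ColexLE] using h₁
  · simpa [ColexLE] using h₂

/-- A long word `w` is colexicographically either above `y`, as is any `x ++ w`, or below `y`,
as is any `x ++ w`. -/
theorem colexLE_append_or (y : List α) {w : List α} (h : y.length ≤ w.length) :
    (∀ x, ColexLE y (x ++ w)) ∨ ∀ x, ColexLE (x ++ w) y := by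
  rcases le_or_gt y.reverse w.reverse with c | c
  · refine Or.inl fun x => ?_
    unfold ColexLE
    rw [List.reverse_append]
    exact c.trans (list_le_append _ _)
  · refine Or.inr fun x => ?_
    unfold ColexLE
    rw [List.reverse_append]
    exact (list_append_lt_of_lt _ c (by simpa using h)).le

end ColexLE

/-! ### Right contexts and states of automata -/

section MyhillNerode

variable {α : Type*} {L : Language α} {x y : List α}

theorem MyhillNerode.append (h : MyhillNerode L x y) (z : List α) :
    MyhillNerode L (x ++ z) (y ++ z) := by
  unfold MyhillNerode at h ⊢
  rw [Language.leftQuotient_append, Language.leftQuotient_append, h]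

theorem MyhillNerode.mem_pref (h : MyhillNerode L x y) (hx : x ∈ pref L) : y ∈ pref L := by
  obtain ⟨z, hz⟩ := hx
  refine ⟨z, ?_⟩
  have hz' : z ∈ L.leftQuotient x := hz
  rw [show L.leftQuotient x = L.leftQuotient y from h] at hz'
  exact hz'

theorem mem_pref_of_append (h : x ++ y ∈ pref L) : x ∈ pref L := by
  obtain ⟨z, hz⟩ := h
  exact ⟨y ++ z, by rwa [← List.append_assoc]⟩

theorem MyhillNerode.append_flatten_replicate (h : MyhillNerode L x (x ++ y)) (k : ℕ) :
    MyhillNerode L x (x ++ (List.replicate k y).flatten) := by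
  induction k with
  | zero => simp [MyhillNerode]
  | succ k ih =>
    rw [List.replicate_succ, List.flatten_cons, ← List.append_assoc]
    exact Eq.trans ih (h.append _)

variable {Q : Type*} {A : NFA α Q}

theorem nfa_eval_append (A : NFA α Q) (x y : List α) :
    A.eval (x ++ y) = A.evalFrom (A.eval x) y := by
  simp only [NFA.eval, NFA.evalFrom, List.foldl_append]

theorem nfa_evalFrom_empty (A : NFA α Q) (x : List α) : A.evalFrom ∅ x = ∅ := by
  induction x with
  | nil => rfl
  | cons a x ih => rw [NFA.evalFrom_cons, NFA.stepSet_empty, ih]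

theorem eval_nonempty_of_mem_pref (hA : A.accepts = L) (h : x ∈ pref L) :
    (A.eval x).Nonempty := by
  obtain ⟨y, hy⟩ := h
  rw [← hA, NFA.mem_accepts] at hy
  obtain ⟨s, -, hs⟩ := hy
  rw [Set.nonempty_iff_ne_empty]
  intro h
  change s ∈ A.eval (x ++ y) at hs
  rw [nfa_eval_append, h, nfa_evalFrom_empty] at hs
  exact hs

theorem myhillNerode_of_eval_eq (hA : A.accepts = L) (h : A.eval x = A.eval y) :
    MyhillNerode L x y := by
  ext z
  rw [Language.mem_leftQuotient, Language.mem_leftQuotient, ← hA, NFA.mem_accepts, NFA.mem_accepts]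
  change (∃ s ∈ A.accept, s ∈ A.eval (x ++ z)) ↔ ∃ s ∈ A.accept, s ∈ A.eval (y ++ z)
  rw [nfa_eval_append, nfa_eval_append, h]

theorem IsDFA.eval_subsingleton (hA : IsDFA A) (x : List α) : (A.eval x).Subsingleton := by
  induction x using List.reverseRecOn with
  | nil =>
    obtain ⟨q, hq⟩ := hA.1
    rw [NFA.eval_nil, hq]
    exact Set.subsingleton_singleton
  | append_singleton x a ih =>
    rw [NFA.eval_append_singleton]
    intro s hs t ht
    obtain ⟨s', hs', hs⟩ := NFA.mem_stepSet.1 hs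
    obtain ⟨t', ht', ht⟩ := NFA.mem_stepSet.1 ht
    obtain rfl := ih hs' ht'
    exact hA.2 _ _ hs ht

/-- The state that a DFA reaches on a word determines the Myhill-Nerode class of the word. -/
theorem IsDFA.exists_state (hA : IsDFA A) (hL : A.accepts = L) :
    ∃ st : pref L → Q, ∀ x y, st x = st y → MyhillNerode L x.1 y.1 := by
  choose st hst using fun x : pref L => eval_nonempty_of_mem_pref hL x.2
  refine ⟨st, fun x y h => myhillNerode_of_eval_eq hL ?_⟩
  rw [(hA.eval_subsingleton x.1).eq_singleton_of_mem (hst x),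
    (hA.eval_subsingleton y.1).eq_singleton_of_mem (hst y), h]

end MyhillNerode

/-! ### Convexity in Wheeler automata -/

section Wheeler

variable {α : Type*} [LinearOrder α] {Q : Type*} [LinearOrder Q] {A : NFA α Q} {L : Language α}
  {x y z : List α} {s t : Q}

/-- States reached by colexicographically ordered words are ordered in the same way, unless both
are reached by both words. -/
theorem IsWheelerNFA.mem_eval_of_lt (hA : IsWheelerNFA A) (hxy : ColexLE x y)
    (hs : s ∈ A.eval x) (ht : t ∈ A.eval y) (hts : t < s) : t ∈ A.eval x ∧ s ∈ A.eval y := by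
  induction x using List.reverseRecOn generalizing y s t with
  | nil =>
    obtain ⟨q, hq, hmin, -⟩ := hA.initial
    rw [NFA.eval_nil, hq] at hs
    obtain rfl : s = q := hs
    exact absurd hts (not_lt.2 (hmin t))
  | append_singleton x a ih =>
    cases y using List.reverseRecOn with
    | nil =>
      unfold ColexLE at hxy
      rw [List.reverse_append] at hxy
      exact absurd hxy (not_le.2 (List.nil_lt_cons _ _))
    | append_singleton y b =>
      have hxy' : a < b ∨ a = b ∧ ColexLE x y := by
        simpa [ColexLE, list_cons_le_cons_iff] using hxy
      rw [NFA.eval_append_singleton] at hs ht ⊢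
      rw [NFA.eval_append_singleton]
      obtain ⟨s', hs', hs⟩ := NFA.mem_stepSet.1 hs
      obtain ⟨t', ht', ht⟩ := NFA.mem_stepSet.1 ht
      rcases hxy' with h | ⟨rfl, h⟩
      · exact absurd hts (hA.lt_of_label_lt hs ht h).asymm
      -- Equal last letters: sources in strict order would force `s ≤ t`, so they coincide or are
      -- themselves inverted, and induction applies.
      · have key : t' ∈ A.eval x ∧ s' ∈ A.eval y := by
          rcases lt_trichotomy s' t' with c | rfl | c
          · exact absurd hts (not_lt.2 (hA.le_of_source_lt hs ht c))
          · exact ⟨hs', ht'⟩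
          · exact ih h hs' ht' c
        exact ⟨NFA.mem_stepSet.2 ⟨t', key.1, ht⟩, NFA.mem_stepSet.2 ⟨s', key.2, hs⟩⟩

/-- The set of words reaching a given state is convex in the set of prefixes of the language. -/
theorem IsWheelerNFA.mem_eval_of_between (hA : IsWheelerNFA A) (hL : A.accepts = L)
    (hy : y ∈ pref L) (hxy : ColexLE x y) (hyz : ColexLE y z) (hx : s ∈ A.eval x)
    (hz : s ∈ A.eval z) : s ∈ A.eval y := by
  obtain ⟨t, ht⟩ := eval_nonempty_of_mem_pref hL hy
  rcases lt_trichotomy s t with c | rfl | c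
  · exact (hA.mem_eval_of_lt hyz ht hz c).1
  · exact ht
  · exact (hA.mem_eval_of_lt hxy hx ht c).2

end Wheeler

/-! ### Pumping and stabilization -/

section Stabilization

/-- A sequence of subsets of a finite set in which each element appears on an interval of indices
is eventually constant. -/
theorem exists_eq_succ_of_convex {Q : Type*} [Finite Q] (I : ℕ → Set Q)
    (hI : ∀ i j k, i ≤ j → j ≤ k → I i ∩ I k ⊆ I j) : ∃ N, I N = I (N + 1) := by
  have h : ∀ s, ∃ N, ∀ n ≥ N, (s ∈ I n ↔ s ∈ I N) := by
    intro s
    -- Either `s` eventually disappears, or it recurs forever and convexity fills the gaps.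
    by_cases h₀ : ∃ M, ∀ n ≥ M, s ∉ I n
    · obtain ⟨M, hM⟩ := h₀
      exact ⟨M, fun n hn => iff_of_false (hM n hn) (hM M le_rfl)⟩
    · push Not at h₀
      obtain ⟨N, -, hN⟩ := h₀ 0
      refine ⟨N, fun n hn => iff_of_true ?_ hN⟩
      obtain ⟨k, hk, hs⟩ := h₀ n
      exact hI N n k hn hk ⟨hN, hs⟩
  choose N hN using h
  obtain ⟨M, hM⟩ := (Set.finite_range N).bddAbove
  have hM' : ∀ s, N s ≤ M := fun s => hM ⟨s, rfl⟩
  refine ⟨M, Set.ext fun s => ?_⟩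
  rw [hN s M (hM' s), hN s (M + 1) ((hM' s).trans M.le_succ)]

variable {α : Type*}

/-- The sequence `x, y, x ++ w, y ++ w, x ++ w ++ w, …` -/
def alternatingPump (x y w : List α) : ℕ → List α
  | 0 => x
  | 1 => y
  | n + 2 => alternatingPump x y w n ++ w

variable {L : Language α} {x y w : List α}

theorem alternatingPump_myhillNerode (hx : MyhillNerode L x (x ++ w))
    (hy : MyhillNerode L y (y ++ w)) (n : ℕ) :
    MyhillNerode L x (alternatingPump x y w n) ∧ MyhillNerode L y (alternatingPump x y w (n + 1)) ∨
    MyhillNerode L y (alternatingPump x y w n) ∧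
      MyhillNerode L x (alternatingPump x y w (n + 1)) := by
  induction n with
  | zero => exact Or.inl ⟨rfl, rfl⟩
  | succ n ih =>
    rcases ih with ⟨h₁, h₂⟩ | ⟨h₁, h₂⟩
    · exact Or.inr ⟨h₂, Eq.trans hx (h₁.append w)⟩
    · exact Or.inl ⟨h₂, Eq.trans hy (h₁.append w)⟩

/-- A general `R` serves both increasing and decreasing chains. -/
theorem alternatingPump_rel {R : List α → List α → Prop}
    (hR : ∀ u v, R u v → R (u ++ w) (v ++ w)) (h₁ : R x y) (h₂ : R y (x ++ w)) (n : ℕ) :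
    R (alternatingPump x y w n) (alternatingPump x y w (n + 1)) := by
  induction n using Nat.twoStepInduction with
  | zero => exact h₁
  | one => exact h₂
  | more n ih _ => exact hR _ _ ih

variable [LinearOrder α]

/-- In a Wheeler language, a colexicographically monotone sequence of prefixes cannot alternate
forever between two Myhill-Nerode classes. -/
theorem IsWheelerLanguage.myhillNerode_of_pump (hL : IsWheelerLanguage L) (hxL : x ∈ pref L)
    (hyL : y ∈ pref L) (hx : MyhillNerode L x (x ++ w)) (hy : MyhillNerode L y (y ++ w))
    (h : (ColexLE x y ∧ ColexLE y (x ++ w)) ∨ (ColexLE y x ∧ ColexLE (x ++ w) y)) :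
    MyhillNerode L x y := by
  obtain ⟨Q, _, _, A, -, hA, hAL⟩ := hL
  set f := alternatingPump x y w with hf
  have hfL : ∀ n, f n ∈ pref L := fun n => by
    rcases alternatingPump_myhillNerode hx hy n with h | h
    · exact h.1.mem_pref hxL
    · exact h.1.mem_pref hyL
  have hconv : ∀ i j k, i ≤ j → j ≤ k → A.eval (f i) ∩ A.eval (f k) ⊆ A.eval (f j) := by
    rintro i j k hij hjk s ⟨hi, hk⟩
    rcases h with h | h
    · have step := alternatingPump_rel (R := ColexLE) (w := w)
        (fun u v => (colexLE_append_right_iff w).2) h.1 h.2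
      have mono : ∀ m n, m ≤ n → ColexLE (f m) (f n) := fun m n hmn =>
        monotone_nat_of_le_succ (f := fun n => (f n).reverse) step hmn
      exact hA.mem_eval_of_between hAL (hfL j) (mono i j hij) (mono j k hjk) hi hk
    · have step := alternatingPump_rel (R := fun u v => ColexLE v u) (w := w)
        (fun u v => (colexLE_append_right_iff w).2) h.1 h.2
      have anti : ∀ m n, m ≤ n → ColexLE (f n) (f m) := fun m n hmn =>
        antitone_nat_of_succ_le (f := fun n => (f n).reverse) step hmn
      exact hA.mem_eval_of_between hAL (hfL j) (anti j k hjk) (anti i j hij) hk hi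
  obtain ⟨N, hN⟩ := exists_eq_succ_of_convex (fun n => A.eval (f n)) hconv
  have hMN : MyhillNerode L (f N) (f (N + 1)) := myhillNerode_of_eval_eq hAL hN
  rcases alternatingPump_myhillNerode hx hy N with h | h
  · exact Eq.trans h.1 (Eq.trans hMN (Eq.symm h.2))
  · exact Eq.symm (Eq.trans h.1 (Eq.trans hMN (Eq.symm h.2)))

/-- If `x ≼ y ≼ x'` where `x` and `x'` are equivalent and a nonempty word `w` is a loop
at the classes of `x` and `y`, then these classes agree. -/
theorem IsWheelerLanguage.myhillNerode_of_between (hL : IsWheelerLanguage L) {x' : List α}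
    (hxL : x ∈ pref L) (hyL : y ∈ pref L) (hxx' : MyhillNerode L x x') (hw : w ≠ [])
    (hx : MyhillNerode L x (x ++ w)) (hy : MyhillNerode L y (y ++ w))
    (h₁ : ColexLE x y) (h₂ : ColexLE y x') : MyhillNerode L x y := by
  have hx' : MyhillNerode L x' (x' ++ w) := Eq.trans (Eq.symm hxx') (Eq.trans hx (hxx'.append w))
  -- Repeating `w` enough to cover `y` makes the comparison with `y` independent of what precedes:
  -- the chain ascends from `x` or descends from `x'`.
  have hlen : y.length ≤ (List.replicate y.length w).flatten.length := by
    have : 1 ≤ w.length := List.length_pos_iff.2 hw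
    simpa using Nat.le_mul_of_pos_right y.length this
  rcases colexLE_append_or y hlen with c | c
  · exact hL.myhillNerode_of_pump hxL hyL (hx.append_flatten_replicate _)
      (hy.append_flatten_replicate _) (Or.inl ⟨h₁, c x⟩)
  · exact Eq.trans hxx' (hL.myhillNerode_of_pump (hxx'.mem_pref hxL) hyL
      (hx'.append_flatten_replicate _) (hy.append_flatten_replicate _) (Or.inr ⟨h₂, c x'⟩))

end Stabilization

/-! ### Cutting loops out of long words -/

section Shortening

variable {α : Type*} [LinearOrder α] {L : Language α} {Q : Type*} [Fintype Q]

theorem exists_lt_of_card_lt {β : Type*} [Fintype β] {m : ℕ} (hm : Fintype.card β ≤ m)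
    (f : ℕ → β) : ∃ i j, i < j ∧ j ≤ m ∧ f i = f j := by
  obtain ⟨i, j, hij, h⟩ := Fintype.exists_ne_map_eq_of_card_lt (fun i : Fin (m + 1) => f i)
    (by simpa using Nat.lt_succ_of_le hm)
  rcases lt_or_gt_of_ne hij with c | c
  · exact ⟨i, j, c, Nat.le_of_lt_succ j.2, h⟩
  · exact ⟨j, i, c, Nat.le_of_lt_succ i.2, h.symm⟩

/-- Two equivalent words `x`, `x'` followed by the same long word `z` have only equivalent
prefixes of the language between them. -/
theorem IsWheelerLanguage.myhillNerode_of_between_append (hL : IsWheelerLanguage L)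
    {st : pref L → Q} (hst : ∀ x y, st x = st y → MyhillNerode L x.1 y.1) {x x' y z : List α}
    (hxx' : MyhillNerode L x x') (hz : Fintype.card Q ^ 2 ≤ z.length) (hx : x ++ z ∈ pref L)
    (hy : y ++ z ∈ pref L) (h₁ : ColexLE x y) (h₂ : ColexLE y x') :
    MyhillNerode L (x ++ z) (y ++ z) := by
  have split : ∀ (u : List α) k, u ++ z = (u ++ z.take k) ++ z.drop k := fun u k => by
    rw [List.append_assoc, List.take_append_drop]
  have hpref : ∀ u, u ++ z ∈ pref L → ∀ k, u ++ z.take k ∈ pref L := fun u hu k =>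
    mem_pref_of_append (y := z.drop k) (by rwa [← split])
  obtain ⟨k, l, hkl, hl, h⟩ := exists_lt_of_card_lt (β := Q × Q) (m := z.length)
    (by rwa [Fintype.card_prod, ← sq])
    (fun k => (st ⟨_, hpref x hx k⟩, st ⟨_, hpref y hy k⟩))
  rw [Prod.mk.injEq] at h
  have htake : z.take l = z.take k ++ (z.take l).drop k := by
    conv_lhs => rw [← List.take_append_drop k (z.take l)]
    rw [List.take_take, min_eq_left hkl.le]
  have hw : (z.take l).drop k ≠ [] := by
    rw [← List.length_pos_iff, List.length_drop, List.length_take]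
    omega
  have hxw := hst _ _ h.1
  have hyw := hst _ _ h.2
  simp only at hxw hyw
  rw [htake, ← List.append_assoc] at hxw hyw
  rw [split x k, split y k]
  exact (hL.myhillNerode_of_between (hpref x hx k) (hpref y hy k) (hxx'.append _) hw hxw hyw
    ((colexLE_append_right_iff _).2 h₁) ((colexLE_append_right_iff _).2 h₂)).append _

/-- Any word in between also ends in `z`, which reduces the comparison to the parts before `z`. -/
theorem IsWheelerLanguage.convexEquiv_append (hL : IsWheelerLanguage L)
    {st : pref L → Q} (hst : ∀ x y, st x = st y → MyhillNerode L x.1 y.1) {x x' z : List α}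
    (hxx' : MyhillNerode L x x') (hz : Fintype.card Q ^ 2 ≤ z.length) (hz₀ : z ≠ [])
    (hx : x ++ z ∈ pref L) : ConvexEquiv L (x ++ z) (x' ++ z) where
  myhillNerode := hxx'.append z
  getLast_eq := by
    rw [List.getLast?_append_of_ne_nil _ hz₀, List.getLast?_append_of_ne_nil _ hz₀]
  convex := by
    intro w hw h
    have key : MyhillNerode L (x ++ z) w := by
      rcases h with h | h
      · obtain ⟨y, rfl, h₁, h₂⟩ := h.1.exists_eq_append h.2
        exact hL.myhillNerode_of_between_append hst hxx' hz hx hw h₁ h₂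
      · obtain ⟨y, rfl, h₁, h₂⟩ := h.1.exists_eq_append h.2
        exact Eq.trans (hxx'.append z) (hL.myhillNerode_of_between_append hst (Eq.symm hxx') hz
          ((hxx'.append z).mem_pref hx) hw h₁ h₂)
    exact ⟨key, Eq.trans (Eq.symm key) (hxx'.append z)⟩

theorem IsWheelerLanguage.exists_shorter (hL : IsWheelerLanguage L)
    {st : pref L → Q} (hst : ∀ x y, st x = st y → MyhillNerode L x.1 y.1) {x : List α}
    (hx : x ∈ pref L) (hlen : Fintype.card Q + Fintype.card Q ^ 2 ≤ x.length) :
    ∃ y ∈ pref L, y.length < x.length ∧ ConvexEquiv L y x := by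
  have hpref : ∀ k, x.take k ∈ pref L := fun k =>
    mem_pref_of_append (y := x.drop k) (by rwa [List.take_append_drop])
  -- Since `j` is at most the number of states, at least its square many letters remain after the
  -- loop.
  obtain ⟨i, j, hij, hj, h⟩ := exists_lt_of_card_lt le_rfl (fun k => st ⟨_, hpref k⟩)
  have hMN : MyhillNerode L (x.take i) (x.take j) := hst _ _ h
  have hpos : 0 < Fintype.card Q ^ 2 := pow_pos (Fintype.card_pos_iff.2 ⟨st ⟨x, hx⟩⟩) 2
  have hz : Fintype.card Q ^ 2 ≤ (x.drop j).length := by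
    rw [List.length_drop]
    omega
  have hx' : x.take i ++ x.drop j ∈ pref L := by
    refine MyhillNerode.mem_pref (Eq.symm (hMN.append (x.drop j))) ?_
    rwa [List.take_append_drop]
  refine ⟨x.take i ++ x.drop j, hx', ?_, ?_⟩
  · rw [List.length_append, List.length_take, List.length_drop]
    omega
  · have := hL.convexEquiv_append hst hMN hz (List.length_pos_iff.1 (hpos.trans_le hz)) hx'
    rwa [List.take_append_drop] at this

theorem IsWheelerLanguage.exists_convexEquiv_length_lt (hL : IsWheelerLanguage L)
    {st : pref L → Q} (hst : ∀ x y, st x = st y → MyhillNerode L x.1 y.1) (x : List α)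
    (hx : x ∈ pref L) :
    ∃ y ∈ pref L, ConvexEquiv L y x ∧ y.length < Fintype.card Q + Fintype.card Q ^ 2 := by
  by_cases h : x.length < Fintype.card Q + Fintype.card Q ^ 2
  · exact ⟨x, hx, ConvexEquiv.refl L x, h⟩
  · obtain ⟨y, hy, hyx, hxy⟩ := hL.exists_shorter hst hx (not_lt.1 h)
    obtain ⟨w, hw, hwy, hlen⟩ := hL.exists_convexEquiv_length_lt hst y hy
    exact ⟨w, hw, hwy.trans hxy, hlen⟩
termination_by x.length

end Shortening

end WheelerLang

theorem mainTheorem8 {α : Type*} [Fintype α] [LinearOrder α] (L : Language α)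
    (hL : WheelerLang.IsWheelerLanguage L)
    {Q : Type*} [Fintype Q] (D : NFA α Q) (hD : WheelerLang.IsMinimumDFA D L) :
    ∀ C ∈ (WheelerLang.convexSetoid L).classes,
      ∃ x ∈ C, x.1.length < Fintype.card Q + Fintype.card Q ^ 2 := by
  rintro C ⟨x, rfl⟩
  obtain ⟨st, hst⟩ := hD.dfa.exists_state hD.accepts_eq
  obtain ⟨y, hy, hyx, hlen⟩ := hL.exists_convexEquiv_length_lt hst x.1 x.2
  exact ⟨⟨y, hy⟩, hyx, hlen⟩
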